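/- Let $\mathscr M$ and $\mathscr N$ be von Neumann algebras of type $\mathrm I_2$, acting on complex Hilbert spaces, and let $\varphi\colon\mathscr M\to\mathscr N$ be a map (not assumed linear or continuous) with the following properties: (i) $\varphi$ is an ortho-isomorphism: $\varphi$ is bijective, and for all $A,B\in\mathscr M$, $A^*B=0$ if and only if $\varphi(A)^*\varphi(B)=0$; (ii) $\varphi$ is ortho-additive: $\varphi(A+B)=\varphi(A)+\varphi(B)$ for all $A,B\in\mathscr M$ with $A^*B=0$. Then there exists a map $\Phi\colon\mathscr M\to\mathscr N$ such that $$\varphi(A)=\Phi(A)\varphi(I)\quad\text{for all }A\in\mathscr M,$$ and $\Phi$ is the direct sum of a $*$-isomorphism and a conjugate $*$-isomorphism; that is, there are central projections $Z\in\mathscr M$ and $W\in\mathscr N$, a $*$-isomorphism $\Phi_1\colon\mathscr MZ\to\mathscr NW$ and a conjugate $*$-isomorphism (a conjugate-linear multiplicative $*$-preserving bijection) $\Phi_2\colon\mathscr M(I-Z)\to\mathscr N(I-W)$ such that $\Phi(A)=\Phi_1(AZ)+\Phi_2(A(I-Z))$ for all $A\in\mathscr M$. (Either summand may be zero.) Here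 a von Neumann algebra is of type $\mathrm I_2$ if its identity is the sum of two orthogonal, Murray–von Neumann equivalent abelian projections. -/

import Mathlib

universe u v

/-- Two elements `a`, `b` of a `*`-algebra are orthogonal if `a* b = 0`. -/
def Orthogonal {R : Type*} [Mul R] [Zero R] [Star R] (a b : R) : Prop :=
  star a * b = 0

/-- `φ (a + b) = φ a + φ b` whenever `a` and `b` are orthogonal. -/
def OrthoAdditive {R S : Type*} [Mul R] [Zero R] [Star R] [Add R] [Add S] (φ : R → S) : Prop :=
  ∀ a b : R, Orthogonal a b → φ (a + b) = φ a + φ b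

/-- A bijection that preserves orthogonality in both directions. -/
def OrthoIsomorphism {R S : Type*} [Mul R] [Zero R] [Star R] [Mul S] [Zero S] [Star S]
    (φ : R → S) : Prop :=
  Function.Bijective φ ∧ ∀ a b : R, Orthogonal a b ↔ Orthogonal (φ a) (φ b)

namespace VonNeumannAlgebra

variable {H : Type u} [NormedAddCommGroup H] [InnerProductSpace ℂ H] [CompleteSpace H]
variable {K : Type v} [NormedAddCommGroup K] [InnerProductSpace ℂ K] [CompleteSpace K]

/-- `p` is an abelian projection of `M`: a projection such that `p M p` is commutative. -/
def IsAbelianProjection (M : VonNeumannAlgebra H) (p : M) : Prop :=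
  IsStarProjection p ∧ ∀ a b : M, (p * a * p) * (p * b * p) = (p * b * p) * (p * a * p)

/-- Murray-von Neumann equivalence in `M`: `v* v = p` and `v v* = q` for some `v` in `M`. (If `p`
is a projection, then such a `v` is automatically a partial isometry.) -/
def MurrayVonNeumannEquiv (M : VonNeumannAlgebra H) (p q : M) : Prop :=
  ∃ v : M, star v * v = p ∧ v * star v = q

/-- `M` is of type `I₂`: its unit is the sum of two orthogonal equivalent abelian projections. -/
def IsTypeI₂ (M : VonNeumannAlgebra H) : Prop :=
  ∃ p q : M, M.IsAbelianProjection p ∧ M.IsAbelianProjection q ∧ Orthogonal p q ∧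
    M.MurrayVonNeumannEquiv p q ∧ p + q = 1

/-- The central projections of `M`. -/
structure CentralProjection (M : VonNeumannAlgebra H) where
  /-- the underlying operator -/
  val : H →L[ℂ] H
  mem : val ∈ M
  isStarProjection : IsStarProjection val
  comm : ∀ a ∈ M, val * a = a * val

/-- The central projection `1 - z`. -/
def CentralProjection.compl {M : VonNeumannAlgebra H} (z : M.CentralProjection) :
    M.CentralProjection where
  val := 1 - z.val
  mem := sub_mem (one_mem M) z.mem
  isStarProjection := z.isStarProjection.one_sub
  comm a ha := by rw [sub_mul, mul_sub, one_mul, mul_one, z.comm a ha]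

/-- The direct summand `M z = {a z | a ∈ M}` of `M`, for a central projection `z`, as a
`*`-algebra of operators (its unit is `z`). -/
def summand (M : VonNeumannAlgebra H) (z : M.CentralProjection) :
    NonUnitalStarSubalgebra ℂ (H →L[ℂ] H) where
  carrier := {x | ∃ a ∈ M, a * z.val = x}
  add_mem' := by
    rintro _ _ ⟨a, ha, rfl⟩ ⟨b, hb, rfl⟩
    exact ⟨a + b, add_mem ha hb, add_mul _ _ _⟩
  zero_mem' := ⟨0, zero_mem M, zero_mul _⟩
  mul_mem' := by
    rintro _ _ ⟨a, ha, rfl⟩ ⟨b, hb, rfl⟩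
    exact ⟨a * z.val * b, mul_mem (mul_mem ha z.mem) hb, mul_assoc _ _ _⟩
  smul_mem' := by
    rintro c _ ⟨a, ha, rfl⟩
    exact ⟨c • a, M.toStarSubalgebra.smul_mem ha c, smul_mul_assoc _ _ _⟩
  star_mem' := by
    rintro _ ⟨a, ha, rfl⟩
    refine ⟨star a, star_mem ha, ?_⟩
    rw [star_mul, z.isStarProjection.isSelfAdjoint.star_eq, z.comm _ (star_mem ha)]

/-- The component `a z` of `a ∈ M` in the summand `M z`. -/
def component {M : VonNeumannAlgebra H} (z : M.CentralProjection) (a : M) : M.summand z :=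
  ⟨(a : H →L[ℂ] H) * z.val, a, a.2, rfl⟩

/-- `Φ : M → N` is the direct sum of a `*`-isomorphism and a conjugate `*`-isomorphism: there are
central projections `z` of `M` and `w` of `N`, a `*`-isomorphism `Φ₁` from `M z` onto `N w` and a
conjugate `*`-isomorphism `Φ₂` (conjugate-linear, multiplicative, `*`-preserving, bijective) from
`M (1 - z)` onto `N (1 - w)` with `Φ = Φ₁ ⊕ Φ₂`. Either summand may be zero. -/
def IsDirectSumStarIsoConjStarIso {M : VonNeumannAlgebra H} {N : VonNeumannAlgebra K}
    (Φ : M → N) : Prop :=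
  ∃ (z : M.CentralProjection) (w : N.CentralProjection)
    (Φ₁ : M.summand z ≃⋆ₐ[ℂ] N.summand w)
    (Φ₂ : M.summand z.compl ≃⋆+* N.summand w.compl),
    (∀ (c : ℂ) (x : M.summand z.compl), Φ₂ (c • x) = star c • Φ₂ x) ∧
    ∀ a : M, (Φ a : K →L[ℂ] K) = Φ₁ (component z a) + Φ₂ (component z.compl a)

end VonNeumannAlgebra

/-! The argument is algebraic until the last part. Take `v` with `e = v* v`, `1 - e = v v*`. The
identity `e(x + y) + v(x - y) = (e + v)x + (e - v)y` has orthogonal summands on each side, so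
ortho-additivity and cancellation of orthogonal components give additivity of `φ`
(`OrthoAdditive.map_add`).

A projection `p` splits `R` into the orthogonal pieces `pR` and `(1 - p)R`, whose images are
orthogonal and sum to `S`. Hence `φ` carries left multiplication by `p` to left multiplication by a
projection. The elements whose left multiplication is so transported form a `*`-subring closed under
inverses. Graph projections show that such a subring is all of `R`
(`mem_of_forall_isStarProjection`), so `φ(xa) = Φ(x)φ(a)` with `Φ` a `*`-ring isomorphism.

For von Neumann algebras, positivity makes `Φ` real-linear, and the central element `Φ(i)`, a square
root of `-1`, splits `N` into a part where it is `i` and a part where it is `-i`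
(`exists_linear_part`). -/

/-- A `*`-ring with proper involution in which all `1 + x* x` are invertible and whose unit is the
sum of two equivalent projections. -/
structure IsHalvedStarRing (R : Type*) [Ring R] [StarRing R] : Prop where
  eq_zero_of_star_mul_self : ∀ a : R, star a * a = 0 → a = 0
  isUnit_one_add_star_mul_self : ∀ a : R, IsUnit (1 + star a * a)
  exists_halving : ∃ v : R, IsStarProjection (star v * v) ∧ star v * v + v * star v = 1

/-! ### Additivity of ortho-additive maps -/

section StarRing

variable {R S : Type*} [Ring R] [StarRing R] [Ring S] [StarRing S]

theorem mul_star_mul_self_of_proper (hR : ∀ a : R, star a * a = 0 → a = 0) {v : R}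
    (hv : IsStarProjection (star v * v)) : v * (star v * v) = v := by
  refine sub_eq_zero.mp (hR _ ?_)
  have h : star v * v * (star v * v) = star v * v := hv.isIdempotentElem
  simp only [star_sub, star_mul, star_star, sub_mul, mul_sub, ← mul_assoc] at h ⊢
  simp only [h, sub_self]

/-- The partial isometry relations for `v` with `v* v + v v* = 1`. -/
theorem halving_relations (hR : ∀ a : R, star a * a = 0 → a = 0) {v : R}
    (hv : IsStarProjection (star v * v)) (hsum : star v * v + v * star v = 1) :
    v * (star v * v) = v ∧ v * v = 0 := by
  have h1 := mul_star_mul_self_of_proper hR hv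
  have hf : v * star v = 1 - star v * v := by rw [← hsum]; abel
  have h2 : star v * v * v = 0 := by
    have : v * star v * v = v := by rw [mul_assoc, h1]
    rw [hf, sub_mul, one_mul, sub_eq_self] at this
    exact this
  refine ⟨h1, ?_⟩
  calc v * v = v * (star v * v) * v := by rw [h1]
    _ = v * (star v * v * v) := by simp only [mul_assoc]
    _ = 0 := by rw [h2, mul_zero]

theorem OrthoAdditive.map_zero {R S : Type*} [Ring R] [StarRing R] [AddGroup S] {φ : R → S} (hφ : OrthoAdditive φ) : φ 0 = 0 := by
  have := hφ 0 0 (by simp [Orthogonal])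
  simpa using this

/-- Cancellation of orthogonal components. -/
theorem eq_of_add_eq_add_of_orthogonal (hS : ∀ a : S, star a * a = 0 → a = 0) {a a' b b' : S}
    (h : a + b = a' + b') (horth : star (a - a') * (b' - b) = 0) : a = a' := by
  have h' : b' - b = a - a' := by rw [sub_eq_sub_iff_add_eq_add, add_comm, ← h, add_comm]
  rw [h'] at horth
  exact sub_eq_zero.mp (hS _ horth)

/-- Since `(e + v)*(e - v) = e - v* v = 0`, the elements `(e + v)x` and `(e - v)y` are orthogonal.
Expanding `φ` of their sum in two ways and comparing the `e` components gives the claim, because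
images of `eR` and `vR` are orthogonal. -/
theorem OrthoAdditive.map_add_on_half (hS : ∀ a : S, star a * a = 0 → a = 0) {φ : R → S}
    (hadd : OrthoAdditive φ) (horth : ∀ a b : R, Orthogonal a b → Orthogonal (φ a) (φ b))
    {v : R} (h1 : v * (star v * v) = v) (h2 : v * v = 0) (x y : R) :
    φ (star v * v * (x + y)) = φ (star v * v * x) + φ (star v * v * y) := by
  set e := star v * v with he
  have hes : star e = e := by simp [he]
  have hev : e * v = 0 := by rw [he, mul_assoc, h2, mul_zero]
  have hve : star v * e = 0 := by simpa [hes] using congrArg star hev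
  have hee : e * e = e := by
    conv_lhs => rw [he]
    rw [mul_assoc, h1]
  have key : ∀ a b : R, Orthogonal (e * a) (v * b) := fun a b => by
    unfold Orthogonal
    rw [star_mul, hes, mul_assoc, ← mul_assoc e, hev, zero_mul, mul_zero]
  have hcross : Orthogonal (e * x + v * x) (e * y + v * -y) := by
    unfold Orthogonal
    have h3 : star (e * x + v * x) = star x * (e + star v) := by
      rw [star_add, star_mul e, star_mul v, hes, mul_add]
    have h4 : e * y + v * -y = (e - v) * y := by rw [sub_mul, mul_neg, sub_eq_add_neg]
    have h5 : (e + star v) * (e - v) = 0 := by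
      rw [add_mul, mul_sub, mul_sub, hee, hev, hve, ← he]; abel
    rw [h3, h4, mul_assoc, ← mul_assoc (e + star v), h5, zero_mul, mul_zero]
  have hsum : e * (x + y) + v * (x - y) = (e * x + v * x) + (e * y + v * -y) := by
    simp only [mul_add, mul_sub, mul_neg]; abel
  have := congrArg φ hsum
  rw [hadd _ _ (key _ _), hadd _ _ hcross, hadd _ _ (key _ _), hadd _ _ (key _ _)] at this
  refine eq_of_add_eq_add_of_orthogonal hS (this.trans (add_add_add_comm _ _ _ _)) ?_
  have hk : ∀ a b : R, star (φ (e * a)) * φ (v * b) = 0 := fun a b => horth _ _ (key a b)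
  have hk' : ∀ a, star (φ (e * a)) * (φ (v * x) + φ (v * -y) - φ (v * (x - y))) = 0 := fun a => by
    rw [mul_sub (star _), mul_add (star _), hk, hk, hk, add_zero, sub_zero]
  rw [star_sub, star_add, sub_mul, add_mul, hk', hk', hk', add_zero, sub_zero]

/-- An ortho-additive map preserving orthogonality is additive. -/
theorem OrthoAdditive.map_add (hR : IsHalvedStarRing R) (hS : ∀ a : S, star a * a = 0 → a = 0)
    {φ : R → S} (hadd : OrthoAdditive φ)
    (horth : ∀ a b : R, Orthogonal a b → Orthogonal (φ a) (φ b)) (x y : R) :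
    φ (x + y) = φ x + φ y := by
  obtain ⟨v, hv, hsum⟩ := hR.exists_halving
  obtain ⟨h1, h2⟩ := halving_relations hR.eq_zero_of_star_mul_self hv hsum
  have he' := hadd.map_add_on_half hS horth h1 h2 x y
  -- Replacing `v` by `v*` interchanges the two halves.
  have h1' : star v * (star (star v) * star v) = star v := by
    simpa [mul_assoc] using congrArg star h1
  have hf' := hadd.map_add_on_half hS horth h1' (by simpa using congrArg star h2) x y
  rw [star_star] at hf'
  have hsplit : ∀ a : R, φ a = φ (star v * v * a) + φ (v * star v * a) := fun a => by
    rw [← hadd, ← add_mul, hsum, one_mul]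
    have : star v * v * (v * star v) = 0 := by
      rw [mul_assoc, ← mul_assoc v, h2, zero_mul, mul_zero]
    rw [Orthogonal, star_mul, hv.isSelfAdjoint.star_eq, mul_assoc, ← mul_assoc _ _ a, this,
      zero_mul, mul_zero]
  rw [hsplit (x + y), hsplit x, hsplit y, he', hf', add_add_add_comm]

/-! ### Transport of left multiplications -/

/-- Left multiplication by `x` and by `x*` on `R` correspond under `φ` to left multiplication by
`y` and by `y*` on `S`. -/
def Intertwines (φ : R → S) (x : R) (y : S) : Prop :=
  (∀ a, φ (x * a) = y * φ a) ∧ ∀ a, φ (star x * a) = star y * φ a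

namespace Intertwines

variable {φ : R → S}

theorem star {x : R} {y : S} (h : Intertwines φ x y) : Intertwines φ (star x) (star y) :=
  ⟨h.2, by simpa using h.1⟩

theorem one : Intertwines φ 1 1 := by simp [Intertwines]

theorem mul {x x' : R} {y y' : S} (h : Intertwines φ x y) (h' : Intertwines φ x' y') :
    Intertwines φ (x * x') (y * y') :=
  ⟨fun a => by rw [mul_assoc, h.1, h'.1, mul_assoc],
    fun a => by rw [star_mul, star_mul, mul_assoc, h'.2, h.2, mul_assoc]⟩

theorem add (hφ : ∀ a b, φ (a + b) = φ a + φ b) {x x' : R} {y y' : S} (h : Intertwines φ x y)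
    (h' : Intertwines φ x' y') : Intertwines φ (x + x') (y + y') :=
  ⟨fun a => by rw [add_mul, hφ, h.1, h'.1, add_mul],
    fun a => by rw [star_add, star_add, add_mul, hφ, h'.2, h.2, add_mul]⟩

theorem eq_of_surjective (hsurj : Function.Surjective φ) {x : R} {y y' : S}
    (h : Intertwines φ x y) (h' : Intertwines φ x y') : y = y' := by
  obtain ⟨a, ha⟩ := hsurj 1
  simpa [ha] using (h.1 a).symm.trans (h'.1 a)

theorem mul_left_cancel (hbij : Function.Bijective φ) {x x' : R}
    {y b c : S} (h : Intertwines φ x y) (hx : x' * x = 1) (hbc : y * b = y * c) : b = c := by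
  obtain ⟨b, rfl⟩ := hbij.2 b
  obtain ⟨c, rfl⟩ := hbij.2 c
  rw [← h.1, ← h.1] at hbc
  have := congrArg (x' * ·) (hbij.1 hbc)
  simp only [← mul_assoc, hx, one_mul] at this
  rw [this]

/-- If `φ u = 1`, an element intertwined with `x'` can only be `φ (x' * u)`. It is a right inverse
of `y`, and left cancellation of `y` makes it two-sided. -/
theorem exists_inverse (hbij : Function.Bijective φ) {x x' : R} {y : S} (h : Intertwines φ x y)
    (hx : x' * x = 1) (hx' : x * x' = 1) : ∃ y', Intertwines φ x' y' := by
  obtain ⟨u, hu⟩ := hbij.2 1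
  have hyy' : y * φ (x' * u) = 1 := by rw [← h.1, ← mul_assoc, hx', one_mul, hu]
  have hy'y : φ (x' * u) * y = 1 := h.mul_left_cancel hbij hx (by
    rw [← mul_assoc, hyy', one_mul, mul_one])
  refine ⟨φ (x' * u), fun a => h.mul_left_cancel hbij hx ?_, fun a => ?_⟩
  · rw [← h.1, ← mul_assoc, ← mul_assoc, hx', hyy', one_mul, one_mul]
  · have hs : Star.star x' * Star.star x = 1 := by rw [← star_mul, hx', star_one]
    have hs' : Star.star x * Star.star x' = 1 := by rw [← star_mul, hx, star_one]
    refine h.star.mul_left_cancel hbij hs ?_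
    rw [← h.2, ← mul_assoc, ← mul_assoc, hs', ← star_mul, hy'y, star_one, one_mul, one_mul]

/-- With `φ u = 1` and `q = φ (p * u)`, orthogonality of `q` and `1 - q` reads `q* = q* q`, so `q`
is a projection. It annihilates the image of `(1 - p)R`, and `1 - q` annihilates that of `pR`. -/
theorem exists_of_isStarProjection (hsurj : Function.Surjective φ)
    (hφ : ∀ a b, φ (a + b) = φ a + φ b)
    (horth : ∀ a b : R, Orthogonal a b → Orthogonal (φ a) (φ b)) {p : R}
    (hp : IsStarProjection p) : ∃ q, Intertwines φ p q := by
  obtain ⟨u, hu⟩ := hsurj 1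
  have hpp : p * (1 - p) = 0 := by rw [mul_sub, hp.isIdempotentElem.eq, mul_one, sub_self]
  have key : ∀ a b : R, Orthogonal (p * a) ((1 - p) * b) := fun a b => by
    rw [Orthogonal, star_mul, hp.isSelfAdjoint.star_eq, mul_assoc, ← mul_assoc p, hpp, zero_mul,
      mul_zero]
  have hsplit : ∀ a, φ a = φ (p * a) + φ ((1 - p) * a) := fun a => by
    rw [← hφ, ← add_mul, add_sub_cancel, one_mul]
  set q := φ (p * u) with hq
  have hq' : φ ((1 - p) * u) = 1 - q := by rw [← hu, hsplit u]; abel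
  have hk : ∀ a b, Star.star (φ (p * a)) * φ ((1 - p) * b) = 0 := fun a b => horth _ _ (key a b)
  have hqs : Star.star q = q := by
    have h := hk u u
    rw [hq', ← hq, mul_sub, mul_one, sub_eq_zero] at h
    conv_rhs => rw [← star_star q, h, star_mul, star_star]
    exact h
  have h : ∀ a, φ (p * a) = q * φ a := fun a => by
    have h1 : q * φ ((1 - p) * a) = 0 := by
      have := hk u a
      rwa [← hq, hqs] at this
    have h2 : (1 - q) * φ (p * a) = 0 := by
      have := congrArg Star.star (hk a u)
      rwa [hq', star_mul, star_star, star_zero, star_sub, star_one, hqs] at this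
    rw [hsplit a, mul_add, h1, add_zero]
    rwa [sub_mul, one_mul, sub_eq_zero] at h2
  exact ⟨q, h, by rwa [hp.isSelfAdjoint.star_eq, hqs]⟩

end Intertwines

/-! ### Generation of the ring by its projections -/

/-- For `x = (1 - e) x e`, the projection onto the graph of `x` has `(e, e)` entry `g e` and
`(1 - e, e)` entry `x g`, where `g` inverts `1 + x* x`. -/
theorem exists_graph_projection {e x g : R} (he : IsStarProjection e) (hxe : x * e = x)
    (hex : e * x = 0) (hg : (1 + star x * x) * g = 1) (hg' : g * (1 + star x * x) = 1) :
    ∃ p : R, IsStarProjection p ∧ e * p * e = e * g ∧ e * g = g * e ∧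
      (1 - e) * p * e = x * g := by
  have hes := he.isSelfAdjoint.star_eq
  have hee : e * e = e := he.isIdempotentElem
  have hex' : e * star x = star x := by simpa [hes] using congrArg star hxe
  have hxe' : star x * e = 0 := by simpa [hes] using congrArg star hex
  have hcomm : Commute e (1 + star x * x) := by
    rw [commute_iff_eq, mul_add, add_mul, mul_one, one_mul, ← mul_assoc, hex', mul_assoc, hxe]
  have heg : e * g = g * e := by
    calc e * g = g * (1 + star x * x) * e * g := by rw [hg', one_mul]
      _ = g * (e * (1 + star x * x)) * g := by rw [mul_assoc g, ← hcomm.eq]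
      _ = g * e * ((1 + star x * x) * g) := by simp only [mul_assoc]
      _ = g * e := by rw [hg, mul_one]
  have hgs : star g = g := by
    have h := congrArg star hg
    simp only [star_mul, star_add, star_one, star_star] at h
    calc star g = star g * ((1 + star x * x) * g) := by rw [hg, mul_one]
      _ = g := by rw [← mul_assoc, h, one_mul]
  -- The element `e + x` parametrizes the graph of `x` by `eR`; this is its Gram element, which `g`
  -- normalizes.
  have hsq : (e + star x) * (e + x) = (1 + star x * x) * e := by
    rw [add_mul, mul_add, mul_add, hee, hex, hxe', add_mul, one_mul, mul_assoc, hxe]; abel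
  have hl : (e + x) * e = e + x := by rw [add_mul, hee, hxe]
  have hr : (e + star x) * e = e := by rw [add_mul, hee, hxe', add_zero]
  have hel : e * (e + x) = e := by rw [mul_add, hee, hex, add_zero]
  refine ⟨(e + x) * g * (e + star x), ⟨?_, ?_⟩, ?_, heg, ?_⟩
  · calc (e + x) * g * (e + star x) * ((e + x) * g * (e + star x))
        = (e + x) * g * ((e + star x) * (e + x)) * g * (e + star x) := by simp only [mul_assoc]
      _ = (e + x) * (g * (1 + star x * x)) * (e * g) * (e + star x) := by
        rw [hsq]; simp only [mul_assoc]
      _ = (e + x) * e * g * (e + star x) := by rw [hg', mul_one]; simp only [mul_assoc]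
      _ = (e + x) * g * (e + star x) := by rw [hl]
  · simp only [IsSelfAdjoint, star_mul, star_add, star_star, hes, hgs, mul_assoc]
  · calc e * ((e + x) * g * (e + star x)) * e
        = (e * (e + x)) * g * ((e + star x) * e) := by simp only [mul_assoc]
      _ = e * g := by rw [hel, hr, mul_assoc, ← heg, ← mul_assoc, hee]
  · calc (1 - e) * ((e + x) * g * (e + star x)) * e
        = ((e + x) - e * (e + x)) * g * ((e + star x) * e) := by
          rw [sub_mul, one_mul, sub_mul]; simp only [sub_mul, mul_assoc]
      _ = x * g := by
        rw [hel, hr, add_sub_cancel_left, mul_assoc, ← heg, ← mul_assoc, hxe]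

/-- A set containing the projections and closed under the `*`-ring operations and inverses is
everything. -/
theorem mem_of_forall_isStarProjection (hR : IsHalvedStarRing R) {T : Subring R}
    (hstar : ∀ a ∈ T, star a ∈ T) (hinv : ∀ a ∈ T, ∀ b, a * b = 1 → b * a = 1 → b ∈ T)
    (hproj : ∀ p : R, IsStarProjection p → p ∈ T) (a : R) : a ∈ T := by
  obtain ⟨v, hv, hsum⟩ := hR.exists_halving
  obtain ⟨h1, h2⟩ := halving_relations hR.eq_zero_of_star_mul_self hv hsum
  set e := star v * v with he
  have hes := hv.isSelfAdjoint.star_eq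
  have hee : e * e = e := hv.isIdempotentElem
  have hev : e * v = 0 := by rw [he, mul_assoc, h2, mul_zero]
  have hf : v * star v = 1 - e := by rw [← hsum]; abel
  have hoff : ∀ x : R, x * e = x → e * x = 0 → x ∈ T := fun x hxe hex => by
    obtain ⟨g, hg, hg'⟩ := isUnit_iff_exists.mp (hR.isUnit_one_add_star_mul_self x)
    obtain ⟨p, hp, hpe, heg, hpf⟩ := exists_graph_projection hv hxe hex hg hg'
    have heT := hproj e hv
    have hfT := hproj _ hv.one_sub
    have hgT : e * g ∈ T := hpe ▸ T.mul_mem (T.mul_mem heT (hproj p hp)) heT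
    have hxg : x * g ∈ T := hpf ▸ T.mul_mem (T.mul_mem hfT (hproj p hp)) heT
    have hxh : e * (1 + star x * x) = (1 + star x * x) * e := by
      have hex' : e * star x = star x := by simpa [hes] using congrArg star hxe
      rw [mul_add, add_mul, mul_one, one_mul, ← mul_assoc, hex', mul_assoc, hxe]
    have hA : ∀ b c : R, b * c = 1 → e * b = b * e →
        (e * b + (1 - e)) * (e * c + (1 - e)) = 1 := fun b c hbc hb => by
      calc (e * b + (1 - e)) * (e * c + (1 - e))
          = e * b * e * c + (e * b - e * b * e) + (e - e * e) * c + (1 - e - e + e * e) := by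
            noncomm_ring
        _ = 1 := by
            rw [mul_assoc e b e, ← hb, ← mul_assoc, hee, mul_assoc, hbc]
            noncomm_ring
    -- The corner element `e * g` is padded by `1 - e` so that it becomes invertible in the whole
    -- ring, where closure under inverses applies.
    have hmem : e * (1 + star x * x) + (1 - e) ∈ T :=
      hinv _ (T.add_mem hgT hfT) _ (hA _ _ hg' heg) (hA _ _ hg hxh)
    have : x * g * (e * (1 + star x * x) + (1 - e)) = x := by
      calc x * g * (e * (1 + star x * x) + (1 - e))
          = x * (g * e) * (1 + star x * x) + (x * g - x * (g * e)) := by noncomm_ring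
        _ = x * (g * (1 + star x * x)) := by
            rw [← heg, ← mul_assoc, hxe, sub_self, add_zero, mul_assoc]
        _ = x := by rw [hg', mul_one]
    exact this ▸ T.mul_mem hxg hmem
  have hoff' : ∀ x : R, e * x = x → x * e = 0 → x ∈ T := fun x hex hxe => by
    rw [← star_star x]
    exact hstar _ (hoff _ (by simpa [hes] using congrArg star hex)
      (by simpa [hes] using congrArg star hxe))
  have hvT : v ∈ T := hoff v h1 hev
  have hsv : star v * e = 0 := by simpa [hes] using congrArg star hev
  -- A diagonal entry is a product of the two off-diagonal elements `e * x * star v` and `v`.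
  have hdiag : ∀ x : R, e * x * e ∈ T := fun x => by
    have : e * x * star v * v = e * x * e := by rw [mul_assoc _ _ v, ← he]
    rw [← this]
    refine T.mul_mem (hoff' _ ?_ ?_) hvT
    · rw [← mul_assoc, ← mul_assoc, hee]
    · rw [mul_assoc, hsv, mul_zero]
  have hdecomp : a = e * a * e + e * (a * v) * e * star v + v * (e * (star v * a) * e)
      + v * (e * (star v * a * v) * e) * star v := by
    have h3 : v * e = v := h1
    have h4 : e * star v = star v := by simpa [hes] using congrArg star h3
    have h5 : e * a * v * e * star v = e * a * (1 - e) := by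
      rw [mul_assoc _ v e, h3, mul_assoc, hf]
    have h6 : v * (e * (star v * a) * e) = (1 - e) * a * e := by
      rw [← hf]; simp only [← mul_assoc]; rw [h3]
    have h7 : v * (e * (star v * a * v) * e) * star v = (1 - e) * a * (1 - e) := by
      rw [← hf]; simp only [← mul_assoc]; rw [h3, mul_assoc _ v e, h3]
    rw [h6, h7, ← mul_assoc e a v, h5]
    noncomm_ring
  rw [hdecomp]
  have hsvT := hstar v hvT
  exact T.add_mem (T.add_mem (T.add_mem (hdiag _) (T.mul_mem (hdiag _) hsvT))
    (T.mul_mem hvT (hdiag _))) (T.mul_mem (T.mul_mem hvT (hdiag _)) hsvT)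

/-! ### The `*`-ring isomorphism -/

theorem exists_intertwines (hR : IsHalvedStarRing R) (hS : ∀ a : S, star a * a = 0 → a = 0)
    {φ : R → S} (hadd : OrthoAdditive φ) (hbij : Function.Bijective φ)
    (horth : ∀ a b : R, Orthogonal a b → Orthogonal (φ a) (φ b)) (x : R) :
    ∃ y, Intertwines φ x y := by
  have hφ := hadd.map_add hR hS horth
  have hproj : ∀ p : R, IsStarProjection p → ∃ q, Intertwines φ p q := fun p hp =>
    Intertwines.exists_of_isStarProjection hbij.2 hφ horth hp
  have hneg : ∀ a, φ (-a) = -φ a := fun a => by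
    rw [eq_neg_iff_add_eq_zero, ← hφ, neg_add_cancel, hadd.map_zero]
  let T : Subring R :=
    { carrier := {x | ∃ y, Intertwines φ x y}
      mul_mem' := fun ⟨_, h⟩ ⟨_, h'⟩ => ⟨_, h.mul h'⟩
      one_mem' := ⟨1, Intertwines.one⟩
      add_mem' := fun ⟨_, h⟩ ⟨_, h'⟩ => ⟨_, h.add hφ h'⟩
      zero_mem' := hproj 0 (IsStarProjection.zero _)
      neg_mem' := fun ⟨y, h⟩ => ⟨-y, fun a => by rw [neg_mul, hneg, h.1, neg_mul],
        fun a => by rw [star_neg, star_neg, neg_mul, hneg, h.2, neg_mul]⟩ }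
  exact mem_of_forall_isStarProjection hR (T := T) (fun a ⟨y, h⟩ => ⟨_, h.star⟩)
    (fun a ⟨y, h⟩ b hab hba => h.exists_inverse hbij hba hab) hproj x

/-- An ortho-additive ortho-isomorphism is a `*`-ring isomorphism followed by right multiplication
by the image of `1`. -/
theorem OrthoIsomorphism.exists_starRingEquiv (hR : IsHalvedStarRing R) (hS : IsHalvedStarRing S)
    {φ : R → S} (hadd : OrthoAdditive φ) (hiso : OrthoIsomorphism φ) :
    ∃ Φ : R ≃⋆+* S, ∀ a, φ a = Φ a * φ 1 := by
  obtain ⟨hbij, horth⟩ := hiso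
  have hφ := hadd.map_add hR hS.eq_zero_of_star_mul_self fun a b => (horth a b).1
  choose Φ hΦ using exists_intertwines hR hS.eq_zero_of_star_mul_self hadd hbij
    fun a b => (horth a b).1
  have huniq : ∀ {x y}, Intertwines φ x y → Φ x = y := fun h => (hΦ _).eq_of_surjective hbij.2 h
  have happly : ∀ a, φ a = Φ a * φ 1 := fun a => by rw [← (hΦ a).1, mul_one]
  let ψ := (Equiv.ofBijective φ hbij).symm
  have hψφ : ∀ a, ψ (φ a) = a := (Equiv.ofBijective φ hbij).symm_apply_apply
  have hφψ : ∀ b, φ (ψ b) = b := (Equiv.ofBijective φ hbij).apply_symm_apply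
  have hψadd : OrthoAdditive ψ := fun a b _ => hbij.1 (by rw [hφ, hφψ, hφψ, hφψ])
  -- Transport along the inverse of `φ` yields surjectivity of `Φ`.
  have hψ := exists_intertwines hS hR.eq_zero_of_star_mul_self hψadd
    (Equiv.ofBijective φ hbij).symm.bijective
    fun a b h => (horth _ _).2 (by rwa [hφψ, hφψ])
  refine ⟨StarRingEquiv.ofBijective (⟨⟨⟨Φ, fun x y => huniq ((hΦ x).mul (hΦ y))⟩,
    huniq ⟨by simp [hadd.map_zero], by simp [hadd.map_zero]⟩,
    fun x y => huniq ((hΦ x).add hφ (hΦ y))⟩, fun x => huniq (hΦ x).star⟩ : R →⋆ₙ+* S)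
    ⟨fun a b h => hbij.1 ?_, fun y => ?_⟩, happly⟩
  · have h' : Φ a = Φ b := h
    rw [happly a, happly b, h']
  · obtain ⟨x, hx⟩ := hψ y
    refine ⟨x, huniq ⟨fun a => ?_, fun a => ?_⟩⟩
    · rw [← hψφ a, ← hx.1, hφψ, hφψ]
    · rw [← hψφ a, ← hx.2, hφψ, hφψ]

end StarRing

/-! ### Action of `*`-ring isomorphisms on scalars -/

namespace VonNeumannAlgebra

open scoped InnerProductSpace

variable {H : Type u} [NormedAddCommGroup H] [InnerProductSpace ℂ H] [CompleteSpace H]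
variable {K : Type v} [NormedAddCommGroup K] [InnerProductSpace ℂ K] [CompleteSpace K]

theorem smul_one_mem (M : VonNeumannAlgebra H) (c : ℂ) : c • (1 : H →L[ℂ] H) ∈ M :=
  M.toStarSubalgebra.smul_mem (one_mem M) c

/-- The inverse commutes with everything that commutes with `a`, so the double commutant theorem
applies. -/
theorem mem_of_mul_eq_one (M : VonNeumannAlgebra H) {a b : H →L[ℂ] H} (ha : a ∈ M)
    (hab : a * b = 1) (hba : b * a = 1) : b ∈ M := by
  rw [← M.commutant_commutant, mem_commutant_iff]
  intro c hc
  have h := mem_commutant_iff.mp hc a ha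
  calc c * b = b * (a * c) * b := by rw [← mul_assoc, hba, one_mul]
    _ = b * c := by rw [h, mul_assoc, mul_assoc, hab, mul_one]

theorem isUnit_one_add_star_mul_self (a : H →L[ℂ] H) : IsUnit (1 + star a * a) :=
  CStarAlgebra.isUnit_of_le 1 (le_add_of_nonneg_right (star_mul_self_nonneg a))

theorem IsTypeI₂.isHalvedStarRing {M : VonNeumannAlgebra H} (hM : M.IsTypeI₂) :
    IsHalvedStarRing M where
  eq_zero_of_star_mul_self a ha :=
    Subtype.ext (CStarRing.star_mul_self_eq_zero_iff _ |>.mp (congrArg Subtype.val ha))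
  isUnit_one_add_star_mul_self a := by
    obtain ⟨b, hab, hba⟩ := isUnit_iff_exists.mp (isUnit_one_add_star_mul_self (a : H →L[ℂ] H))
    have hb := M.mem_of_mul_eq_one (add_mem (one_mem M) (mul_mem (star_mem a.2) a.2)) hab hba
    exact isUnit_iff_exists.mpr ⟨⟨b, hb⟩, Subtype.ext hab, Subtype.ext hba⟩
  exists_halving := by
    obtain ⟨p, q, hp, -, -, ⟨v, rfl, rfl⟩, hsum⟩ := hM
    exact ⟨v, hp.1, hsum⟩

/-- The scalar operators, as a ring homomorphism into `M`. -/
noncomputable def scalar (M : VonNeumannAlgebra H) : ℂ →+* M :=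
  (algebraMap ℂ (H →L[ℂ] H)).codRestrict M fun c => by
    rw [Algebra.algebraMap_eq_smul_one]; exact M.smul_one_mem c

theorem coe_scalar (M : VonNeumannAlgebra H) (c : ℂ) :
    (M.scalar c : H →L[ℂ] H) = c • (1 : H →L[ℂ] H) :=
  Algebra.algebraMap_eq_smul_one c

theorem scalar_mul_comm (M : VonNeumannAlgebra H) (c : ℂ) (a : M) :
    M.scalar c * a = a * M.scalar c := by
  apply Subtype.ext
  change (M.scalar c : H →L[ℂ] H) * a = a * (M.scalar c : H →L[ℂ] H)
  simp [coe_scalar]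

theorem star_scalar (M : VonNeumannAlgebra H) (c : ℂ) : star (M.scalar c) = M.scalar (star c) := by
  apply Subtype.ext
  change star (M.scalar c : H →L[ℂ] H) = _
  simp [coe_scalar]

section StarRingEquiv

variable {M : VonNeumannAlgebra H} {N : VonNeumannAlgebra K} (Φ : M ≃⋆+* N)

/-- The scalar `r` is the square of the self-adjoint scalar `√r`, a form that ring isomorphisms
preserve. -/
theorem re_inner_map_scalar_nonneg {r : ℝ} (hr : 0 ≤ r) (x : K) :
    0 ≤ (⟪(Φ (M.scalar r) : K →L[ℂ] K) x, x⟫_ℂ).re := by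
  set T := Φ (M.scalar (Real.sqrt r)) with hT
  have hTs : star T = T := by
    rw [hT, ← map_star, star_scalar]; simp
  have h : Φ (M.scalar r) = star T * T := by
    rw [hTs, hT, ← map_mul, ← map_mul, ← Complex.ofReal_mul, Real.mul_self_sqrt hr]
  rw [h]
  change 0 ≤ (⟪(star (T : K →L[ℂ] K) * (T : K →L[ℂ] K)) x, x⟫_ℂ).re
  rw [mul_apply_eq_comp, ContinuousLinearMap.star_eq_adjoint,
    ContinuousLinearMap.adjoint_inner_left]
  exact inner_self_nonneg (𝕜 := ℂ)

theorem map_scalar_ratCast (q : ℚ) : Φ (M.scalar q) = N.scalar q :=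
  RingHom.congr_fun (RingHom.ext_rat
    (((Φ : M ≃+* N) : M →+* N).comp (M.scalar.comp (Rat.castHom ℂ)))
    (N.scalar.comp (Rat.castHom ℂ))) q

/-- A `*`-ring isomorphism of von Neumann algebras is real-linear. -/
theorem map_scalar_ofReal (r : ℝ) : Φ (M.scalar r) = N.scalar r := by
  apply Subtype.ext
  rw [coe_scalar]
  set T := (Φ (M.scalar r) : K →L[ℂ] K) with hT
  have hTs : IsSelfAdjoint T := by
    have h : star (Φ (M.scalar r)) = Φ (M.scalar r) := by
      rw [← map_star, star_scalar]; simp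
    exact congrArg Subtype.val h
  have hsub : ∀ (s t : ℝ) (x : K), (⟪(Φ (M.scalar (s - t : ℝ)) : K →L[ℂ] K) x, x⟫_ℂ).re
      = (⟪(Φ (M.scalar s) : K →L[ℂ] K) x, x⟫_ℂ).re
        - (⟪(Φ (M.scalar t) : K →L[ℂ] K) x, x⟫_ℂ).re := fun s t x => by
    rw [Complex.ofReal_sub, map_sub, map_sub]
    change (⟪((Φ (M.scalar s) : K →L[ℂ] K) - (Φ (M.scalar t) : K →L[ℂ] K)) x, x⟫_ℂ).re = _
    rw [sub_apply, inner_sub_left, Complex.sub_re]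
  have hxx : ∀ x : K, ⟪x, x⟫_ℂ = ((‖x‖ ^ 2 : ℝ) : ℂ) := fun x => by
    rw [inner_self_eq_norm_sq_to_K, Complex.ofReal_pow]; rfl
  have hrat : ∀ (q : ℚ) (x : K), (⟪(Φ (M.scalar (q : ℝ)) : K →L[ℂ] K) x, x⟫_ℂ).re
      = q * ‖x‖ ^ 2 := fun q x => by
    rw [Complex.ofReal_ratCast, map_scalar_ratCast, coe_scalar, smul_apply,
      one_apply_eq_self, inner_smul_left, hxx]
    simp [-Complex.ofReal_pow]
  -- Order preservation squeezes the quadratic form between its values at rational scalars. No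
  -- continuity of `Φ` is needed.
  have hre : ∀ x : K, (⟪T x, x⟫_ℂ).re = r * ‖x‖ ^ 2 := fun x => by
    rcases eq_or_ne x 0 with rfl | hx
    · simp
    have hpos : 0 < ‖x‖ ^ 2 := by positivity
    rw [← div_eq_iff hpos.ne']
    apply le_antisymm
    · refine le_of_forall_lt_rat_imp_le fun q hq => ?_
      have h := re_inner_map_scalar_nonneg Φ (sub_nonneg.mpr hq.le) x
      rw [hsub, hrat, ← hT] at h
      rw [div_le_iff₀ hpos]; linarith
    · refine le_of_forall_rat_lt_imp_le fun q hq => ?_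
      have h := re_inner_map_scalar_nonneg Φ (sub_nonneg.mpr hq.le) x
      rw [hsub, hrat, ← hT] at h
      rw [le_div_iff₀ hpos]; linarith
  apply ContinuousLinearMap.coe_injective
  rw [← ext_inner_map]
  intro x
  have him : (⟪T x, x⟫_ℂ).im = 0 := by
    have h : ⟪T x, x⟫_ℂ = ⟪x, T x⟫_ℂ := by
      rw [← ContinuousLinearMap.adjoint_inner_left, ← ContinuousLinearMap.star_eq_adjoint,
        hTs.star_eq]
    rw [← Complex.conj_eq_iff_im, inner_conj_symm, h]
  change ⟪T x, x⟫_ℂ = ⟪((r : ℂ) • (1 : K →L[ℂ] K)) x, x⟫_ℂ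
  rw [smul_apply, one_apply_eq_self, inner_smul_left, hxx]
  apply Complex.ext
  · rw [hre]; simp [-Complex.ofReal_pow]
  · rw [him]; simp [-Complex.ofReal_pow]

/-- The central projection on which a `*`-ring isomorphism is linear. -/
theorem exists_linear_part : ∃ w : N.CentralProjection, ∀ c : ℂ,
    (Φ (M.scalar c) : K →L[ℂ] K) * w.val = c • w.val ∧
    (Φ (M.scalar c) : K →L[ℂ] K) * w.compl.val = star c • w.compl.val := by
  set J := (Φ (M.scalar Complex.I) : K →L[ℂ] K) with hJ
  have hJJ : J * J = -1 := by
    have h : Φ (M.scalar Complex.I) * Φ (M.scalar Complex.I) = -1 := by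
      rw [← map_mul, ← map_mul, Complex.I_mul_I, map_neg, map_neg, map_one, map_one]
    exact congrArg Subtype.val h
  have hJs : star J = -J := by
    have h : star (Φ (M.scalar Complex.I)) = -Φ (M.scalar Complex.I) := by
      rw [← map_star, star_scalar, Complex.star_def, Complex.conj_I, map_neg, map_neg]
    exact congrArg Subtype.val h
  have hJc : ∀ a ∈ N, J * a = a * J := fun a ha => by
    have h : Φ (M.scalar Complex.I) * ⟨a, ha⟩ = ⟨a, ha⟩ * Φ (M.scalar Complex.I) := by
      rw [← Φ.apply_symm_apply ⟨a, ha⟩, ← map_mul, scalar_mul_comm, map_mul]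
    exact congrArg Subtype.val h
  have hc : ∀ c : ℂ, (Φ (M.scalar c) : K →L[ℂ] K) = (c.re : ℂ) • 1 + (c.im : ℂ) • J := fun c => by
    have h : Φ (M.scalar c) = N.scalar c.re + N.scalar c.im * Φ (M.scalar Complex.I) := by
      conv_lhs => rw [← Complex.re_add_im c]
      rw [map_add, map_mul, map_add, map_mul, map_scalar_ofReal, map_scalar_ofReal]
    have h' := congrArg Subtype.val h
    change _ = (N.scalar c.re : K →L[ℂ] K) + (N.scalar c.im : K →L[ℂ] K) * J at h'
    rw [h', coe_scalar, coe_scalar, smul_mul_assoc, one_mul]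
  -- Projection onto the `i`-eigenspace of `J`; on the complement `J` acts as `-i`, whence
  -- conjugation.
  have hw : IsStarProjection ((1 / 2 : ℂ) • ((1 : K →L[ℂ] K) - Complex.I • J)) := by
    constructor
    · have h : (1 - Complex.I • J) * (1 - Complex.I • J)
          = (2 : ℂ) • ((1 : K →L[ℂ] K) - Complex.I • J) := by
        simp only [mul_sub, sub_mul, smul_mul_smul_comm, hJJ, Complex.I_mul_I, mul_one, one_mul]
        module
      rw [IsIdempotentElem, smul_mul_smul_comm, h, smul_smul]
      norm_num
    · rw [IsSelfAdjoint, star_smul, star_sub, star_smul, hJs]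
      simp
  refine ⟨⟨(1 / 2 : ℂ) • (1 - Complex.I • J), ?_, hw, fun a ha => ?_⟩, fun c => ⟨?_, ?_⟩⟩
  · exact N.toStarSubalgebra.smul_mem (sub_mem (one_mem N)
      (N.toStarSubalgebra.smul_mem (Φ (M.scalar Complex.I)).2 _)) _
  · simp only [smul_mul_assoc, mul_smul_comm, sub_mul, mul_sub, hJc a ha, one_mul, mul_one]
  · rw [hc]
    conv_rhs => rw [← Complex.re_add_im c]
    simp only [smul_mul_assoc, mul_smul_comm, mul_sub, add_mul, hJJ, one_mul, mul_one]
    match_scalars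
    · ring
    · linear_combination (c.im / 2 : ℂ) * Complex.I_sq
  · rw [hc]
    have hcc : star c = c.re - c.im * Complex.I := by
      apply Complex.ext <;> simp
    rw [hcc]
    simp only [CentralProjection.compl, smul_mul_assoc, mul_smul_comm, mul_sub, add_mul, hJJ,
      one_mul, mul_one]
    match_scalars
    · ring
    · linear_combination (c.im / 2 : ℂ) * Complex.I_sq

end StarRingEquiv

/-! ### Splitting into linear and conjugate-linear summands -/

theorem mem_summand {M : VonNeumannAlgebra H} {z : M.CentralProjection} {x : H →L[ℂ] H} :
    x ∈ M.summand z ↔ x ∈ M ∧ x * z.val = x := by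
  refine ⟨?_, fun h => ⟨x, h⟩⟩
  rintro ⟨a, ha, rfl⟩
  exact ⟨mul_mem ha z.mem, by rw [mul_assoc, z.isStarProjection.isIdempotentElem.eq]⟩

/-- A `*`-ring isomorphism carrying the central projection `z` to `w` restricts to the summands. -/
noncomputable def summandEquiv {M : VonNeumannAlgebra H} {N : VonNeumannAlgebra K} (Φ : M ≃⋆+* N)
    {z : M.CentralProjection} {w : N.CentralProjection}
    (h : (Φ ⟨z.val, z.mem⟩ : K →L[ℂ] K) = w.val) : M.summand z ≃⋆+* N.summand w where
  toFun x := ⟨Φ ⟨x, (mem_summand.mp x.2).1⟩, mem_summand.mpr ⟨(Φ _).2, by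
    rw [← h]
    exact congrArg Subtype.val ((map_mul Φ _ _).symm.trans
      (congrArg Φ (Subtype.ext (mem_summand.mp x.2).2)))⟩⟩
  invFun y := ⟨Φ.symm ⟨y, (mem_summand.mp y.2).1⟩, mem_summand.mpr ⟨(Φ.symm _).2, by
    have hz : Φ.symm ⟨w.val, w.mem⟩ = ⟨z.val, z.mem⟩ :=
      EquivLike.injective Φ ((Φ.apply_symm_apply _).trans (Subtype.ext h.symm))
    rw [show z.val = (Φ.symm ⟨w.val, w.mem⟩ : H →L[ℂ] H) by rw [hz]]
    exact congrArg Subtype.val ((map_mul Φ.symm _ _).symm.trans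
      (congrArg Φ.symm (Subtype.ext (mem_summand.mp y.2).2)))⟩⟩
  left_inv x := by
    have h := congrArg Subtype.val (Φ.symm_apply_apply ⟨(x : H →L[ℂ] H), (mem_summand.mp x.2).1⟩)
    exact Subtype.ext h
  right_inv y := by
    have h := congrArg Subtype.val (Φ.apply_symm_apply ⟨(y : K →L[ℂ] K), (mem_summand.mp y.2).1⟩)
    exact Subtype.ext h
  map_mul' x y := by
    have h := congrArg Subtype.val (map_mul Φ ⟨(x : H →L[ℂ] H), (mem_summand.mp x.2).1⟩
      ⟨(y : H →L[ℂ] H), (mem_summand.mp y.2).1⟩)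
    exact Subtype.ext h
  map_add' x y := by
    have h := congrArg Subtype.val (map_add Φ ⟨(x : H →L[ℂ] H), (mem_summand.mp x.2).1⟩
      ⟨(y : H →L[ℂ] H), (mem_summand.mp y.2).1⟩)
    exact Subtype.ext h
  map_star' x := by
    have h := congrArg Subtype.val (map_star Φ ⟨(x : H →L[ℂ] H), (mem_summand.mp x.2).1⟩)
    exact Subtype.ext h

theorem coe_summandEquiv {M : VonNeumannAlgebra H} {N : VonNeumannAlgebra K} (Φ : M ≃⋆+* N)
    {z : M.CentralProjection} {w : N.CentralProjection}
    (h : (Φ ⟨z.val, z.mem⟩ : K →L[ℂ] K) = w.val) (x : M.summand z) :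
    (summandEquiv Φ h x : K →L[ℂ] K) = Φ ⟨x, (mem_summand.mp x.2).1⟩ :=
  rfl

/-- Serves both summands: `d = c` on the linear one and `d = star c` on the conjugate-linear one. -/
theorem coe_summandEquiv_smul {M : VonNeumannAlgebra H} {N : VonNeumannAlgebra K} (Φ : M ≃⋆+* N)
    {z : M.CentralProjection} {w : N.CentralProjection}
    (h : (Φ ⟨z.val, z.mem⟩ : K →L[ℂ] K) = w.val) {c d : ℂ}
    (hc : (Φ (M.scalar c) : K →L[ℂ] K) * w.val = d • w.val) (x : M.summand z) :
    summandEquiv Φ h (c • x) = d • summandEquiv Φ h x := by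
  apply Subtype.ext
  have hx : (⟨(c • x : M.summand z), (mem_summand.mp (c • x).2).1⟩ : M)
      = ⟨x, (mem_summand.mp x.2).1⟩ * M.scalar c := by
    apply Subtype.ext
    change c • (x : H →L[ℂ] H) = (x : H →L[ℂ] H) * (M.scalar c : H →L[ℂ] H)
    rw [coe_scalar, mul_smul_comm, mul_one]
  have hy := (mem_summand.mp (summandEquiv Φ h x).2).2
  rw [coe_summandEquiv] at hy
  rw [coe_summandEquiv, hx, ← scalar_mul_comm, map_mul]
  change (Φ (M.scalar c) : K →L[ℂ] K) * (Φ ⟨x, (mem_summand.mp x.2).1⟩ : K →L[ℂ] K)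
    = d • (Φ ⟨x, (mem_summand.mp x.2).1⟩ : K →L[ℂ] K)
  rw [← hy, ← w.comm _ (Φ _).2, ← mul_assoc, hc, smul_mul_assoc]

/-- A `*`-ring isomorphism of von Neumann algebras is the direct sum of a `*`-isomorphism and a
conjugate `*`-isomorphism. -/
theorem isDirectSumStarIsoConjStarIso_of_starRingEquiv {M : VonNeumannAlgebra H}
    {N : VonNeumannAlgebra K} (Φ : M ≃⋆+* N) : IsDirectSumStarIsoConjStarIso Φ := by
  obtain ⟨w, hw⟩ := exists_linear_part Φ
  set p := Φ.symm ⟨w.val, w.mem⟩ with hp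
  have hΦp : Φ p = ⟨w.val, w.mem⟩ := Φ.apply_symm_apply _
  let z : M.CentralProjection :=
    { val := p
      mem := p.2
      isStarProjection := by
        constructor
        · have h : p * p = p := EquivLike.injective Φ (by
            rw [map_mul, hΦp]
            exact Subtype.ext w.isStarProjection.isIdempotentElem)
          exact congrArg Subtype.val h
        · have h : star p = p := EquivLike.injective Φ (by
            rw [map_star, hΦp]
            exact Subtype.ext w.isStarProjection.isSelfAdjoint)
          exact congrArg Subtype.val h
      comm := fun a ha => by
        have h : p * ⟨a, ha⟩ = ⟨a, ha⟩ * p := EquivLike.injective Φ (by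
          rw [map_mul, map_mul, hΦp]
          exact Subtype.ext (w.comm _ (Φ ⟨a, ha⟩).2))
        exact congrArg Subtype.val h }
  have hz : (Φ ⟨z.val, z.mem⟩ : K →L[ℂ] K) = w.val := congrArg Subtype.val hΦp
  have hz' : (Φ ⟨z.compl.val, z.compl.mem⟩ : K →L[ℂ] K) = w.compl.val := by
    have h : Φ (1 - p) = 1 - ⟨w.val, w.mem⟩ := by rw [map_sub, map_one, hΦp]
    exact congrArg Subtype.val h
  refine ⟨z, w, ⟨summandEquiv Φ hz, fun c => coe_summandEquiv_smul Φ hz (hw c).1⟩, summandEquiv Φ hz',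
    fun c => coe_summandEquiv_smul Φ hz' (hw c).2, fun a => ?_⟩
  have h : Φ a = Φ (a * p) + Φ (a * (1 - p)) := by
    rw [← map_add, ← mul_add, add_sub_cancel, mul_one]
  exact congrArg Subtype.val h

end VonNeumannAlgebra

theorem proposition4p5
    {H : Type u} [NormedAddCommGroup H] [InnerProductSpace ℂ H] [CompleteSpace H]
    {K : Type v} [NormedAddCommGroup K] [InnerProductSpace ℂ K] [CompleteSpace K]
    (M : VonNeumannAlgebra H) (N : VonNeumannAlgebra K)
    (hM : M.IsTypeI₂) (hN : N.IsTypeI₂)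
    (φ : M → N) (hadd : OrthoAdditive φ) (hiso : OrthoIsomorphism φ) :
    ∃ Φ : M → N, VonNeumannAlgebra.IsDirectSumStarIsoConjStarIso Φ ∧
      ∀ A : M, φ A = Φ A * φ 1 := by
  obtain ⟨Φ, hΦ⟩ := hiso.exists_starRingEquiv hM.isHalvedStarRing hN.isHalvedStarRing hadd
  exact ⟨Φ, VonNeumannAlgebra.isDirectSumStarIsoConjStarIso_of_starRingEquiv Φ, hΦ⟩
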